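/- Let $a,b,c,d\in\mathbb{R}$ with $a,c>0$ and $b,d<0$, put $A(z)=az+b$, $B(z)=cz+d$, and let $x_A=-b/a$ and $x_B=-d/c$ be their zeros. Assume $x_A<x_B$. Let $(W_n(z))_{n\ge0}$ be the polynomials with $W_0(z)=1$, $W_1(z)=z$ and $$W_n(z)=(az+b)W_{n-1}(z)+(cz+d)W_{n-2}(z)\qquad(n\ge2).$$ Put $\Delta_\Delta=c^2-a^2B(x_A)$ (which is positive), $\Delta_g=(b+c)^2+4d(1-a)$ and $F=\Delta_g-\Delta_\Delta$. Let $$x_\Delta^{\pm}=x_A+\frac{-2c\pm2\sqrt{\Delta_\Delta}}{a^2}$$ be the zeros of $\Delta(z)=A(z)^2+4B(z)$, and let $$x_g^\pm=\frac{b+c}{2(1-a)}\pm\frac{\sqrt{\Delta_g}}{2|1-a|}\ \text{ if } a\ne1,\qquad x_g^\pm=-\frac{d}{b+c}\ \text{ if } a=1 \text{ and } b+c\neq0,$$ be the zeros of $g(z)=(1-a)z^2-(b+c)z-d$. Define $$(u,v)=\begin{cases}(x_\Delta^-,x_\Delta^+),&\text{if } a<2 \text{ and } F\le0;\\ (x_g^-,x_g^+),&\text{if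 } a>2 \text{ and } F<0;\\ (x_g^+,x_\Delta^+),&\text{if } a<1 \text{ and } F>0;\\ (x_g^-,x_\Delta^+),&\text{otherwise.}\end{cases}$$ (If $a=1$ and $b+c=0$, then $F<0$, so the first case applies; $x_g^\pm$ is real in every case in which it is used.) Then every $W_n$ is real-rooted, that is, all its complex zeros are real. Let $R_n$ be the set of zeros of $W_n$. For every $n\ge0$ we have $R_n\subset(u,v)$, and $R_{n+1}$ strictly interlaces $R_n$; here a finite set $X\subset\mathbb{R}$ strictly interlaces a finite set $Y\subset\mathbb{R}$ if $|X|-|Y|\in\{0,1\}$ and their elements can be arranged so that $x_1<y_1<x_2<y_2<\cdots$. Moreover, the bound $(u,v)$ is sharp in the sense that both $u$ and $v$ are limits of zeros: for each of them there are zeros $z_n\in\mathbb{C}$ of $W_n$, one for each $n\ge1$, that converge to it. -/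

import Mathlib

open Polynomial

noncomputable section

namespace LinearRecurrence

/-- The normalized sequence of polynomials with `W_0 = 1`, `W_1 = z` and
`W_n = (a z + b) W_{n-1} + (c z + d) W_{n-2}` for `n ≥ 2`. -/
def W (a b c d : ℝ) : ℕ → ℝ[X]
  | 0 => 1
  | 1 => X
  | (n + 2) => (C a * X + C b) * W a b c d (n + 1) + (C c * X + C d) * W a b c d n

/-- The zero `x_A` of `A(z) = a z + b`. -/
def xA (a b : ℝ) : ℝ := -b / a

/-- The zero `x_B` of `B(z) = c z + d`. -/
def xB (c d : ℝ) : ℝ := -d / c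

/-- `Δ_Δ = c² - a² B(x_A)`, where `B(z) = c z + d`. -/
def discDelta (a b c d : ℝ) : ℝ := c ^ 2 - a ^ 2 * (c * xA a b + d)

/-- The smaller zero `x_Δ⁻` of `Δ(z) = (a z + b)² + 4 (c z + d)`. -/
def xDeltaMinus (a b c d : ℝ) : ℝ :=
  xA a b + (-2 * c - 2 * √(discDelta a b c d)) / a ^ 2

/-- The larger zero `x_Δ⁺` of `Δ(z) = (a z + b)² + 4 (c z + d)`. -/
def xDeltaPlus (a b c d : ℝ) : ℝ :=
  xA a b + (-2 * c + 2 * √(discDelta a b c d)) / a ^ 2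

/-- The discriminant `Δ_g` of `g(z) = (1 - a) z² - (b + c) z - d`. -/
def discG (a b c d : ℝ) : ℝ := (b + c) ^ 2 + 4 * d * (1 - a)

/-- The zero `x_g⁻` of `g(z) = (1 - a) z² - (b + c) z - d`: the smaller one for `a ≠ 1`,
the only one for `a = 1` and `b + c ≠ 0`. (It is not used when `a = 1` and `b + c = 0`.) -/
def xGMinus (a b c d : ℝ) : ℝ :=
  if a = 1 then -d / (b + c)
  else (b + c) / (2 * (1 - a)) - √(discG a b c d) / (2 * |1 - a|)

/-- The zero `x_g⁺` of `g(z) = (1 - a) z² - (b + c) z - d`: the larger one for `a ≠ 1`,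
the only one for `a = 1` and `b + c ≠ 0`. (It is not used when `a = 1` and `b + c = 0`.) -/
def xGPlus (a b c d : ℝ) : ℝ :=
  if a = 1 then -d / (b + c)
  else (b + c) / (2 * (1 - a)) + √(discG a b c d) / (2 * |1 - a|)

/-- `F = Δ_g - Δ_Δ`. -/
def F (a b c d : ℝ) : ℝ := discG a b c d - discDelta a b c d

/-- The pair `(u, v)` of end points. -/
def uv (a b c d : ℝ) : ℝ × ℝ :=
  if a < 2 ∧ F a b c d ≤ 0 then (xDeltaMinus a b c d, xDeltaPlus a b c d)
  else if 2 < a ∧ F a b c d < 0 then (xGMinus a b c d, xGPlus a b c d)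
  else if a < 1 ∧ 0 < F a b c d then (xGPlus a b c d, xDeltaPlus a b c d)
  else (xGMinus a b c d, xDeltaPlus a b c d)

/-- The left end point `u`. -/
def u (a b c d : ℝ) : ℝ := (uv a b c d).1

/-- The right end point `v`. -/
def v (a b c d : ℝ) : ℝ := (uv a b c d).2

/-- A real polynomial is real-rooted if all its complex zeros are real. -/
def RealRooted (p : ℝ[X]) : Prop := ∀ z : ℂ, aeval z p = 0 → z.im = 0

/-- The set of real zeros of a real polynomial (all the zeros, if it is real-rooted). -/
def zeroSet (p : ℝ[X]) : Set ℝ := {x : ℝ | p.eval x = 0}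

/-- `S` strictly interlaces `T`: both are finite, `|S| - |T| ∈ {0, 1}`, and the elements of `S`
and of `T` can be arranged so that `s_0 < t_0 < s_1 < t_1 < ⋯`. (The chain of inequalities forces
the listed elements to be distinct, so that `|S| = k` and `|T| = m`.) -/
def StrictlyInterlaces (S T : Set ℝ) : Prop :=
  ∃ (k m : ℕ) (s t : ℕ → ℝ), (k = m ∨ k = m + 1) ∧
    S = s '' Set.Iio k ∧ T = t '' Set.Iio m ∧
    (∀ i, i < m → s i < t i) ∧ (∀ i, i + 1 < k → t i < s (i + 1))

/-- `z` is a limit of zeros of the sequence `P` if there are (complex) zeros `ζ n` of `P n`,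
one for each `n ≥ 1`, that converge to `z`. (The index `0` is left out, as `W_0 = 1` has no
zeros.) -/
def IsLimitOfZeros (P : ℕ → ℝ[X]) (z : ℂ) : Prop :=
  ∃ ζ : ℕ → ℂ, (∀ n, 1 ≤ n → aeval (ζ n) (P n) = 0) ∧
    Filter.Tendsto ζ Filter.atTop (nhds z)

end LinearRecurrence

end

/-! Fix a real x. Then W_n(x) solves a recurrence with constant coefficients p = A(x), q = B(x), and
its ratios r = W_{n+1}/W_n follow r ↦ p + q/r from the start r = x. For q < 0 this map increases on
r > 0. If 0 < l ≤ x and l is not moved down, all ratios stay at least l and W_n(x) > 0 for all n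
(`pos_of_le_ratio`). If every r in (0, x] is moved down, with r² - pr - q bounded away from 0, the
ratios drop by a fixed amount per step and some W_n(x) ≤ 0 (`exists_nonpos_of_gap`). Applied to
(-1)^n W_n, the same dichotomy governs the left side.

The end points u and v bound the regions where these signs persist. At a zero s of W_{n+1} one has
W_{n+2}(s) = B(s) W_n(s) with B(s) < 0, because all W_n are positive where B ≥ 0. Hence W_{n+2}
changes sign along u, the zeros of W_{n+1}, and v, which gives real-rootedness and interlacing
together. For sharpness, a point just inside u or v has the wrong sign for some W_N, so W_N has a
zero between it and the end point; interlacing keeps such a zero for every larger index.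

Identifying u and v is elementary algebra: 4g = (2x - A)² - Δ, and at b/(2 - a), the point where
A(x) = 2x, Δ has the sign of F and g the opposite sign. -/

namespace LinearRecurrence

/-! ### Positivity for scalar recurrences with constant coefficients -/

section ScalarRecurrence

variable {w : ℕ → ℝ} {p q y : ℝ}

/-- If `l > 0` satisfies `l² ≤ p l + q` and the first ratio is at least `l`, then the solution of
`w (n + 2) = p w (n + 1) + q w n` with `q < 0` stays positive. -/
lemma pos_of_le_ratio (h0 : w 0 = 1) (h1 : w 1 = y)
    (hw : ∀ n, w (n + 2) = p * w (n + 1) + q * w n) (hq : q < 0) {l : ℝ} (hl : 0 < l)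
    (hly : l ≤ y) (hlq : l ^ 2 ≤ p * l + q) (n : ℕ) : 0 < w n := by
  have key : ∀ n, 0 < w n ∧ l * w n ≤ w (n + 1) := by
    intro n
    induction n with
    | zero => rw [h0, h1]; exact ⟨one_pos, by linarith⟩
    | succ n ih =>
      obtain ⟨hn, hn1⟩ := ih
      have hpos : 0 < w (n + 1) := lt_of_lt_of_le (mul_pos hl hn) hn1
      refine ⟨hpos, ?_⟩
      rw [hw n]
      have e1 : q * w (n + 1) ≤ q * (l * w n) := mul_le_mul_of_nonpos_left hn1 hq.le
      have e2 : l ^ 2 * w (n + 1) ≤ (p * l + q) * w (n + 1) :=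
        mul_le_mul_of_nonneg_right hlq hpos.le
      -- The next ratio bound multiplied by l, so that no quotient is needed.
      have e3 : l * (l * w (n + 1)) ≤ l * (p * w (n + 1) + q * w n) := by nlinarith
      exact le_of_mul_le_mul_left e3 hl
  exact (key n).1

/-- If `p, y > 0` and `q ≥ 0`, then the solution of
`w (n + 2) = p w (n + 1) + q w n` stays positive. -/
lemma pos_of_nonneg_coeff (h0 : w 0 = 1) (h1 : w 1 = y)
    (hw : ∀ n, w (n + 2) = p * w (n + 1) + q * w n) (hp : 0 < p) (hq : 0 ≤ q) (hy : 0 < y)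
    (n : ℕ) : 0 < w n := by
  have key : ∀ n, 0 < w n ∧ 0 < w (n + 1) := by
    intro n
    induction n with
    | zero => rw [h0, h1]; exact ⟨one_pos, hy⟩
    | succ n ih =>
      refine ⟨ih.2, ?_⟩
      rw [hw n]
      have := mul_pos hp ih.2
      have := mul_nonneg hq ih.1.le
      linarith
  exact (key n).1

/-- If `r² - p r - q` is bounded below by some `ε > 0` for `0 < r ≤ y`, then the solution of
`w (n + 2) = p w (n + 1) + q w n` does not stay positive. -/
lemma exists_nonpos_of_gap (h0 : w 0 = 1) (h1 : w 1 = y)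
    (hw : ∀ n, w (n + 2) = p * w (n + 1) + q * w n) {ε : ℝ} (hε : 0 < ε)
    (hgap : ∀ r, 0 < r → r ≤ y → ε ≤ r ^ 2 - p * r - q) : ∃ n, w n ≤ 0 := by
  by_contra! hpos
  have hy : 0 < y := h1 ▸ hpos 1
  -- One step lowers the ratio r by (r² - pr - q)/r ≥ ε/r ≥ ε/y.
  have key : ∀ n : ℕ, w (n + 1) / w n ≤ y - n * (ε / y) := by
    intro n
    induction n with
    | zero => simp [h0, h1]
    | succ n ih =>
      set r := w (n + 1) / w n with hr
      have hw0 := hpos n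
      have hw1 := hpos (n + 1)
      have hr0 : 0 < r := div_pos hw1 hw0
      have hry : r ≤ y := by
        have : 0 ≤ n * (ε / y) := by positivity
        linarith
      have e : w (n + 1 + 1) / w (n + 1) = r - (r ^ 2 - p * r - q) / r := by
        rw [hw n, hr]
        field_simp
        ring
      have e2 : ε / y ≤ (r ^ 2 - p * r - q) / r :=
        div_le_div₀ (hε.le.trans (hgap r hr0 hry)) (hgap r hr0 hry) hr0 hry
      rw [e]
      push_cast
      linarith
  obtain ⟨n, hn⟩ := exists_nat_gt (y / (ε / y))
  have hpos' : 0 < ε / y := div_pos hε hy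
  rw [div_lt_iff₀ hpos'] at hn
  have := key n
  have : 0 < w (n + 1) / w n := div_pos (hpos _) (hpos _)
  linarith

/-- The gap criterion for a negative discriminant, or for a first ratio below both
characteristic roots. -/
lemma exists_nonpos (h0 : w 0 = 1) (h1 : w 1 = y)
    (hw : ∀ n, w (n + 2) = p * w (n + 1) + q * w n)
    (h : p ^ 2 + 4 * q < 0 ∨ 2 * y < p ∧ 0 < y ^ 2 - p * y - q) : ∃ n, w n ≤ 0 := by
  rcases h with h | ⟨h2, hg⟩
  -- This ε is the minimum of r² - pr - q, attained at r = p/2.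
  · refine exists_nonpos_of_gap h0 h1 hw (ε := -(p ^ 2 + 4 * q) / 4) (by linarith) ?_
    intro r _ _
    nlinarith [sq_nonneg (2 * r - p)]
  -- Left of p/2 the parabola decreases, so its value at y is the minimum over r ≤ y.
  · refine exists_nonpos_of_gap h0 h1 hw hg ?_
    intro r _ hr
    nlinarith

/-- Two choices of the lower bound l for the ratios: the midpoint p/2 of the characteristic roots,
where pl + q - l² is a quarter of the discriminant, or the starting ratio y itself. -/
lemma pos_of_disc_nonneg (h0 : w 0 = 1) (h1 : w 1 = y)
    (hw : ∀ n, w (n + 2) = p * w (n + 1) + q * w n) (hq : q < 0)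
    (h : (0 < p ∧ p ≤ 2 * y ∧ 0 ≤ p ^ 2 + 4 * q) ∨ (0 < y ∧ y ^ 2 - p * y - q ≤ 0)) (n : ℕ) :
    0 < w n := by
  rcases h with ⟨hp, hpy, hD⟩ | ⟨hy, hg⟩
  · exact pos_of_le_ratio h0 h1 hw hq (l := p / 2) (by linarith) (by linarith) (by nlinarith) n
  · exact pos_of_le_ratio h0 h1 hw hq hy le_rfl (by linarith) n

end ScalarRecurrence

/-! ### Values, degree and leading coefficient of W_n -/

section Evaluation

variable (a b c d x : ℝ)

lemma eval_W_succ_succ (n : ℕ) : (W a b c d (n + 2)).eval x =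
    (a * x + b) * (W a b c d (n + 1)).eval x + (c * x + d) * (W a b c d n).eval x := by
  simp [W]

lemma eval_W_alternating (n : ℕ) : (-1) ^ (n + 2) * (W a b c d (n + 2)).eval x =
    -(a * x + b) * ((-1) ^ (n + 1) * (W a b c d (n + 1)).eval x) +
      (c * x + d) * ((-1) ^ n * (W a b c d n).eval x) := by
  rw [eval_W_succ_succ]; ring

end Evaluation

section Degree

variable {a : ℝ} (b c d : ℝ)

lemma natDegree_W_and_leadingCoeff_pos (ha : 0 < a) (n : ℕ) :
    (W a b c d n).natDegree = n ∧ 0 < (W a b c d n).leadingCoeff := by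
  have key : ∀ n, (((W a b c d n).natDegree = n ∧ 0 < (W a b c d n).leadingCoeff) ∧
      ((W a b c d (n + 1)).natDegree = n + 1 ∧ 0 < (W a b c d (n + 1)).leadingCoeff)) := by
    intro n
    induction n with
    | zero => simp [W]
    | succ n ih =>
      obtain ⟨⟨h0, l0⟩, h1, l1⟩ := ih
      refine ⟨⟨h1, l1⟩, ?_⟩
      have hdeg : ((C a * X + C b) * W a b c d (n + 1)).natDegree = n + 2 := by
        have hne : W a b c d (n + 1) ≠ 0 := fun h => by simp [h] at l1
        have hne' : (C a * X + C b : ℝ[X]) ≠ 0 := by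
          intro h
          have := natDegree_linear (b := b) ha.ne'
          simp [h] at this
        rw [natDegree_mul hne' hne, natDegree_linear ha.ne', h1]
        ring
      have hlc : ((C a * X + C b) * W a b c d (n + 1)).leadingCoeff =
          a * (W a b c d (n + 1)).leadingCoeff := by
        rw [leadingCoeff_mul, leadingCoeff_linear ha.ne']
      have hsmall : ((C c * X + C d) * W a b c d n).natDegree < n + 2 := by
        calc _ ≤ (C c * X + C d : ℝ[X]).natDegree + (W a b c d n).natDegree := natDegree_mul_le
          _ ≤ 1 + n := by rw [h0]; gcongr; exact natDegree_linear_le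
          _ < n + 2 := by omega
      have hlt : ((C c * X + C d) * W a b c d n).natDegree <
          ((C a * X + C b) * W a b c d (n + 1)).natDegree := by rw [hdeg]; exact hsmall
      constructor
      · change ((C a * X + C b) * W a b c d (n + 1) + (C c * X + C d) * W a b c d n).natDegree = _
        rw [natDegree_add_eq_left_of_natDegree_lt hlt, hdeg]
      · change 0 < ((C a * X + C b) * W a b c d (n + 1) +
          (C c * X + C d) * W a b c d n).leadingCoeff
        rw [leadingCoeff_add_of_degree_lt' (degree_lt_degree hlt), hlc]
        exact mul_pos ha l1
  exact (key n).1

end Degree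

/-! ### Factorization over distinct roots, and signs between them -/

section Factorization

/-- A polynomial of degree `n` with `n` distinct roots splits. -/
lemma eq_C_mul_prod_of_roots {P : ℝ[X]} {n : ℕ} (hP : P ≠ 0) (hdeg : P.natDegree = n)
    {s : ℕ → ℝ} (hs : ∀ i j, i < j → j < n → s i < s j) (hr : ∀ i, i < n → P.eval (s i) = 0) :
    P = C P.leadingCoeff * ∏ j ∈ Finset.range n, (X - C (s j)) := by
  have hinj : Set.InjOn s (Finset.range n) := by
    intro i hi j hj hij
    simp only [Finset.coe_range, Set.mem_Iio] at hi hj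
    rcases lt_trichotomy i j with h | h | h
    · exact absurd hij (hs i j h hj).ne
    · exact h
    · exact absurd hij (hs j i h hi).ne'
  have hle : (Finset.range n).val.map s ≤ P.roots := by
    rw [Multiset.le_iff_subset]
    · intro x hx
      obtain ⟨i, hi, rfl⟩ := Multiset.mem_map.1 hx
      exact (mem_roots hP).2 (hr i (Finset.mem_range.1 hi))
    · exact Multiset.Nodup.map_on (fun i hi j hj => hinj hi hj) (Finset.range n).nodup
  have hcard : Multiset.card P.roots ≤ n := hdeg ▸ card_roots' P
  have heq : (Finset.range n).val.map s = P.roots :=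
    Multiset.eq_of_le_of_card_le hle (by simpa using hcard)
  have hc : Multiset.card P.roots = P.natDegree := by rw [← heq, hdeg]; simp
  have := C_leadingCoeff_mul_prod_multiset_X_sub_C hc
  rw [← heq, Multiset.map_map] at this
  exact this.symm

/-- Each of the n - i roots right of x contributes one sign; the exponent n + i has the same parity
and avoids subtraction. -/
lemma prod_sub_sign {s : ℕ → ℝ} {x : ℝ} {n i : ℕ} (hin : i ≤ n) (hlt : ∀ j, j < i → s j < x)
    (hgt : ∀ j, i ≤ j → j < n → x < s j) :
    0 < (-1) ^ (n + i) * ∏ j ∈ Finset.range n, (x - s j) := by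
  induction n, hin using Nat.le_induction with
  | base =>
    rw [← two_mul, pow_mul, neg_one_sq, one_pow, one_mul]
    exact Finset.prod_pos fun j hj => sub_pos.2 (hlt j (Finset.mem_range.1 hj))
  | succ n hin ih =>
    have h := ih fun j h1 h2 => hgt j h1 (by omega)
    have h2 := hgt n hin (Nat.lt_succ_self n)
    rw [Finset.prod_range_succ]
    have : (-1 : ℝ) ^ (n + 1 + i) * ((∏ j ∈ Finset.range n, (x - s j)) * (x - s n)) =
      ((-1) ^ (n + i) * ∏ j ∈ Finset.range n, (x - s j)) * (s n - x) := by ring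
    rw [this]
    exact mul_pos h (sub_pos.2 h2)

lemma exists_root_between (P : ℝ[X]) {x y : ℝ} (hxy : x < y) (h : P.eval x * P.eval y < 0) :
    ∃ z, x < z ∧ z < y ∧ P.eval z = 0 := by
  have hc : ContinuousOn (fun t => P.eval t) (Set.Icc x y) := P.continuous.continuousOn
  rcases mul_neg_iff.1 h with ⟨h1, h2⟩ | ⟨h1, h2⟩
  · obtain ⟨z, hz, hz0⟩ := intermediate_value_Ioo' hxy.le hc ⟨h2, h1⟩
    exact ⟨z, hz.1, hz.2, hz0⟩
  · obtain ⟨z, hz, hz0⟩ := intermediate_value_Ioo hxy.le hc ⟨h1, h2⟩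
    exact ⟨z, hz.1, hz.2, hz0⟩

end Factorization

/-- `s 0 < ⋯ < s (n - 1)` are roots of `P`. -/
def IsRootList (P : ℝ[X]) (n : ℕ) (s : ℕ → ℝ) : Prop :=
  (∀ i j, i < j → j < n → s i < s j) ∧ ∀ i, i < n → P.eval (s i) = 0

/-! ### Interlacing by counting sign changes -/

section Interlacing

variable {a b c d : ℝ}

lemma W_eq_prod (ha : 0 < a) {n : ℕ} {s : ℕ → ℝ} (hs : IsRootList (W a b c d n) n s) :
    W a b c d n = C (W a b c d n).leadingCoeff * ∏ j ∈ Finset.range n, (X - C (s j)) := by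
  obtain ⟨hdeg, hlc⟩ := natDegree_W_and_leadingCoeff_pos b c d ha n
  exact eq_C_mul_prod_of_roots (fun h => by simp [h] at hlc) hdeg hs.1 hs.2

lemma zeroSet_W (ha : 0 < a) {n : ℕ} {s : ℕ → ℝ} (hs : IsRootList (W a b c d n) n s) :
    zeroSet (W a b c d n) = s '' Set.Iio n := by
  obtain ⟨-, hlc⟩ := natDegree_W_and_leadingCoeff_pos b c d ha n
  ext x
  constructor
  · intro hx
    change (W a b c d n).eval x = 0 at hx
    rw [W_eq_prod ha hs, eval_mul, eval_prod, eval_C] at hx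
    obtain ⟨j, hj, h0⟩ := Finset.prod_eq_zero_iff.1 ((mul_eq_zero.1 hx).resolve_left hlc.ne')
    refine ⟨j, Finset.mem_range.1 hj, ?_⟩
    simp only [eval_sub, eval_X, eval_C] at h0
    linarith
  · rintro ⟨i, hi, rfl⟩
    exact hs.2 i hi

lemma realRooted_W (ha : 0 < a) {n : ℕ} {s : ℕ → ℝ} (hs : IsRootList (W a b c d n) n s) :
    RealRooted (W a b c d n) := by
  obtain ⟨-, hlc⟩ := natDegree_W_and_leadingCoeff_pos b c d ha n
  intro z hz
  rw [W_eq_prod ha hs, map_mul, map_prod, aeval_C] at hz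
  have hne : algebraMap ℝ ℂ (W a b c d n).leadingCoeff ≠ 0 := by simpa using hlc.ne'
  obtain ⟨j, -, h0⟩ := Finset.prod_eq_zero_iff.1 ((mul_eq_zero.1 hz).resolve_left hne)
  simp only [map_sub, aeval_X, aeval_C, Complex.coe_algebraMap] at h0
  rw [sub_eq_zero.1 h0]
  exact Complex.ofReal_im _

lemma sign_eval_W (ha : 0 < a) {n i : ℕ} {t : ℕ → ℝ} (ht : IsRootList (W a b c d n) n t) {x : ℝ}
    (hin : i ≤ n) (hlt : ∀ j, j < i → t j < x) (hgt : ∀ j, i ≤ j → j < n → x < t j) :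
    0 < (-1) ^ (n + i) * (W a b c d n).eval x := by
  obtain ⟨-, hlc⟩ := natDegree_W_and_leadingCoeff_pos b c d ha n
  have h := mul_pos hlc (prod_sub_sign hin hlt hgt)
  rw [W_eq_prod ha ht, eval_mul, eval_prod, eval_C]
  simp only [eval_sub, eval_X, eval_C]
  linarith

variable {u v : ℝ}

/-- The root lists `s` of `W_{n+1}` and `t` of `W_n` interlace. -/
def InterlacingLists (a b c d : ℝ) (n : ℕ) (s t : ℕ → ℝ) : Prop :=
  IsRootList (W a b c d (n + 1)) (n + 1) s ∧ IsRootList (W a b c d n) n t ∧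
    (∀ i, i < n → s i < t i) ∧ ∀ i, i < n → t i < s (i + 1)

/-- The induction step: the sign changes of `W_{n+2}` at the roots `s` of `W_{n+1}`. -/
lemma exists_interlacingLists_succ (ha : 0 < a)
    (hB : ∀ n x, (W a b c d n).eval x = 0 → c * x + d < 0)
    (hU : ∀ x, x ≤ u → ∀ n, 0 < (-1) ^ n * (W a b c d n).eval x)
    (hV : ∀ x, v ≤ x → ∀ n, 0 < (W a b c d n).eval x) {n : ℕ} {s t : ℕ → ℝ}
    (h : InterlacingLists a b c d n s t) : ∃ r, InterlacingLists a b c d (n + 1) r s := by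
  obtain ⟨hs, ht, hst, hts⟩ := h
  have hsle : ∀ i j, i ≤ j → j < n + 1 → s i ≤ s j := by
    intro i j hij hj
    rcases hij.eq_or_lt with rfl | h
    · exact le_rfl
    · exact (hs.1 i j h hj).le
  have hus : ∀ i, i < n + 1 → u < s i := by
    intro i hi
    by_contra! hle
    have := hU _ hle (n + 1)
    rw [hs.2 i hi, mul_zero] at this
    exact this.false
  have hsv : ∀ i, i < n + 1 → s i < v := by
    intro i hi
    by_contra! hle
    have := hV _ hle (n + 1)
    rw [hs.2 i hi] at this
    exact this.false
  have huv : u < v := (hus 0 n.succ_pos).trans (hsv 0 n.succ_pos)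
  -- At a root of W_{n+1} the recurrence reduces to W_{n+2} = B W_n with B < 0, and exactly i roots
  -- of W_n lie left of s i.
  have hsign : ∀ i, i < n + 1 → (-1) ^ (n + i) * (W a b c d (n + 2)).eval (s i) < 0 := by
    intro i hi
    have h1 : 0 < (-1) ^ (n + i) * (W a b c d n).eval (s i) := by
      refine sign_eval_W ha ht (by omega) (fun j hj => ?_) (fun j hij hj => ?_)
      · exact (hts j (by omega)).trans_le (hsle _ _ hj hi)
      · exact (hsle i j hij (by omega)).trans_lt (hst j hj)
    rw [eval_W_succ_succ, hs.2 i hi]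
    have := mul_neg_of_neg_of_pos (hB (n + 1) (s i) (hs.2 i hi)) h1
    linarith
  -- The n + 3 points u, s 0, …, s n, v, at which the sign of W_{n+2} alternates; they enclose n + 2
  -- roots.
  let e : ℕ → ℝ := fun i => if i = 0 then u else if i ≤ n + 1 then s (i - 1) else v
  have e0 : e 0 = u := rfl
  have es : ∀ i, i < n + 1 → e (i + 1) = s i := by
    intro i hi
    simp only [e, Nat.add_sub_cancel]
    rw [if_neg (by omega), if_pos (by omega)]
  have ev : e (n + 2) = v := by
    simp only [e]
    rw [if_neg (by omega), if_neg (by omega)]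
  have hlt : ∀ i j, i < j → j < n + 3 → e i < e j := by
    intro i j hij hj
    obtain ⟨j, rfl⟩ : ∃ k, j = k + 1 := ⟨j - 1, by omega⟩
    rcases Nat.eq_zero_or_pos i with rfl | hi
    · rcases (show j < n + 1 ∨ j = n + 1 by omega) with h | rfl
      · rw [e0, es j h]; exact hus j h
      · rw [e0, ev]; exact huv
    · obtain ⟨i, rfl⟩ : ∃ k, i = k + 1 := ⟨i - 1, by omega⟩
      rcases (show j < n + 1 ∨ j = n + 1 by omega) with h | rfl
      · rw [es i (by omega), es j h]; exact hs.1 i j (by omega) h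
      · rw [es i (by omega), ev]; exact hsv i (by omega)
  have hesign : ∀ i, i < n + 3 → 0 < (-1) ^ (n + i) * (W a b c d (n + 2)).eval (e i) := by
    intro i hi
    rcases Nat.eq_zero_or_pos i with rfl | hi0
    · have := hU u le_rfl (n + 2)
      rw [e0]
      rwa [pow_add, neg_one_sq, mul_one] at this
    · obtain ⟨i, rfl⟩ : ∃ k, i = k + 1 := ⟨i - 1, by omega⟩
      rcases (show i < n + 1 ∨ i = n + 1 by omega) with h | rfl
      · have := hsign i h
        rw [es i h, ← add_assoc, pow_succ]
        linarith
      · rw [ev, show n + (n + 1 + 1) = 2 * (n + 1) by ring, pow_mul, neg_one_sq, one_pow, one_mul]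
        exact hV v le_rfl _
  -- The index bound sits inside the existential so that `choose` yields a sequence on all of ℕ.
  have hex : ∀ i, ∃ z, i < n + 2 → e i < z ∧ z < e (i + 1) ∧ (W a b c d (n + 2)).eval z = 0 := by
    intro i
    by_cases hi : i < n + 2
    · have h1 := mul_pos (hesign i (by omega)) (hesign (i + 1) (by omega))
      have h2 : ((-1 : ℝ) ^ (n + i)) * (-1) ^ (n + i) = 1 := by
        rw [← mul_pow]; simp
      have h3 : (W a b c d (n + 2)).eval (e i) * (W a b c d (n + 2)).eval (e (i + 1)) < 0 := by
        rw [← add_assoc, pow_succ] at h1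
        have : (-1) ^ (n + i) * (W a b c d (n + 2)).eval (e i) *
            ((-1) ^ (n + i) * -1 * (W a b c d (n + 2)).eval (e (i + 1))) =
            -(((-1 : ℝ) ^ (n + i)) * (-1) ^ (n + i)) * ((W a b c d (n + 2)).eval (e i) *
              (W a b c d (n + 2)).eval (e (i + 1))) := by ring
        rw [this, h2] at h1
        linarith
      obtain ⟨z, hz⟩ := exists_root_between _ (hlt i (i + 1) (by omega) (by omega)) h3
      exact ⟨z, fun _ => hz⟩
    · exact ⟨0, fun h => absurd h hi⟩
  choose r hr using hex
  refine ⟨r, ⟨fun i j hij hj => ?_, fun i hi => (hr i hi).2.2⟩, hs, fun i hi => ?_, fun i hi => ?_⟩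
  · have h1 := (hr i (by omega)).2.1
    have h2 := (hr j hj).1
    rcases (show i + 1 = j ∨ i + 1 < j by omega) with h | h
    · rw [h] at h1; exact h1.trans h2
    · exact h1.trans ((hlt _ _ h (by omega)).trans h2)
  · rw [← es i hi]; exact (hr i (by omega)).2.1
  · rw [← es i hi]; exact (hr (i + 1) (by omega)).1

lemma exists_interlacingLists (ha : 0 < a)
    (hB : ∀ n x, (W a b c d n).eval x = 0 → c * x + d < 0)
    (hU : ∀ x, x ≤ u → ∀ n, 0 < (-1) ^ n * (W a b c d n).eval x)
    (hV : ∀ x, v ≤ x → ∀ n, 0 < (W a b c d n).eval x) (n : ℕ) :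
    ∃ s t, InterlacingLists a b c d n s t := by
  induction n with
  | zero =>
    -- The first 0 is the root of W_1 = X; the second list is empty and its value is irrelevant.
    refine ⟨fun _ => 0, fun _ => 0, ⟨fun i j hij hj => by omega, fun i _ => by simp [W]⟩,
      ⟨fun i j hij hj => by omega, fun i hi => by omega⟩, fun i hi => by omega,
      fun i hi => by omega⟩
  | succ n ih =>
    obtain ⟨s, t, h⟩ := ih
    obtain ⟨r, hr⟩ := exists_interlacingLists_succ ha hB hU hV h
    exact ⟨r, s, hr⟩

lemma InterlacingLists.strictlyInterlaces (ha : 0 < a) {n : ℕ} {s t : ℕ → ℝ}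
    (h : InterlacingLists a b c d n s t) :
    StrictlyInterlaces (zeroSet (W a b c d (n + 1))) (zeroSet (W a b c d n)) :=
  ⟨n + 1, n, s, t, Or.inr rfl, zeroSet_W ha h.1, zeroSet_W ha h.2.1, h.2.2.1,
    fun i hi => h.2.2.2 i (by omega)⟩

/-- Every zero of `W_n` lies strictly between two zeros of `W_{n+1}`. -/
lemma InterlacingLists.exists_lt_and_gt (ha : 0 < a) {n : ℕ} {s t : ℕ → ℝ}
    (h : InterlacingLists a b c d n s t) {x : ℝ} (hx : (W a b c d n).eval x = 0) :
    (∃ y, y < x ∧ (W a b c d (n + 1)).eval y = 0) ∧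
      ∃ y, x < y ∧ (W a b c d (n + 1)).eval y = 0 := by
  have hx' : x ∈ zeroSet (W a b c d n) := hx
  rw [zeroSet_W ha h.2.1] at hx'
  obtain ⟨i, hi, rfl⟩ := hx'
  have hi : i < n := hi
  exact ⟨⟨s i, h.2.2.1 i hi, h.1.2 i (by omega)⟩,
    ⟨s (i + 1), h.2.2.2 i hi, h.1.2 (i + 1) (by omega)⟩⟩

end Interlacing

/-! ### End points as limits of zeros -/

section Limits

/-- If every `P n`, `n ≥ 1`, has a real zero, and every neighbourhood of `v` contains a zero of all
but finitely many `P n`, then `v` is a limit of zeros. -/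
lemma isLimitOfZeros_of_eventually {P : ℕ → ℝ[X]} {v : ℝ}
    (hex : ∀ n, 1 ≤ n → ∃ x, (P n).eval x = 0)
    (hnear : ∀ ε > 0, ∃ N, ∀ n, N ≤ n → ∃ x, |x - v| < ε ∧ (P n).eval x = 0) :
    IsLimitOfZeros P (v : ℂ) := by
  -- Choosing a zero nearest to v makes a single sequence work for every ε.
  have hmin : ∀ n, ∃ x : ℝ, 1 ≤ n → (P n).eval x = 0 ∧ ∀ y, (P n).eval y = 0 → |x - v| ≤ |y - v| := by
    intro n
    by_cases hn : 1 ≤ n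
    · by_cases h0 : P n = 0
      · exact ⟨v, fun _ => by simp [h0]⟩
      · obtain ⟨x0, hx0⟩ := hex n hn
        obtain ⟨x, hx, hxm⟩ := (P n).roots.toFinset.exists_min_image (fun x => |x - v|)
          ⟨x0, by simpa [h0] using hx0⟩
        refine ⟨x, fun _ => ⟨by simpa [h0] using hx, fun y hy => hxm y (by simpa [h0] using hy)⟩⟩
    · exact ⟨0, fun h => absurd h hn⟩
  choose ζ hζ using hmin
  refine ⟨fun n => (ζ n : ℂ), fun n hn => ?_, ?_⟩
  · have := (hζ n hn).1
    change aeval (algebraMap ℝ ℂ (ζ n)) (P n) = 0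
    rw [aeval_algebraMap_apply, coe_aeval_eq_eval, this, map_zero]
  · refine (Complex.continuous_ofReal.tendsto v).comp ?_
    rw [Metric.tendsto_atTop]
    intro ε hε
    obtain ⟨N, hN⟩ := hnear ε hε
    refine ⟨max N 1, fun n hn => ?_⟩
    obtain ⟨x, hx, hx0⟩ := hN n ((le_max_left _ _).trans hn)
    rw [Real.dist_eq]
    exact ((hζ n ((le_max_right _ _).trans hn)).2 x hx0).trans_lt hx

variable {a b c d u v : ℝ}

/-- The zeros of `W` when signs are known outside `(u, v)` and fail to persist inside. -/
theorem zeros_of_sign_conditions (ha : 0 < a)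
    (hB : ∀ n x, (W a b c d n).eval x = 0 → c * x + d < 0)
    (hU : ∀ x, x ≤ u → ∀ n, 0 < (-1) ^ n * (W a b c d n).eval x)
    (hV : ∀ x, v ≤ x → ∀ n, 0 < (W a b c d n).eval x)
    (hU' : ∃ m > u, ∀ x, u < x → x < m → ∃ n, (-1) ^ n * (W a b c d n).eval x ≤ 0)
    (hV' : ∃ m < v, ∀ x, m < x → x < v → ∃ n, (W a b c d n).eval x ≤ 0) :
    (∀ n, RealRooted (W a b c d n)) ∧ (∀ n, zeroSet (W a b c d n) ⊆ Set.Ioo u v) ∧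
    (∀ n, StrictlyInterlaces (zeroSet (W a b c d (n + 1))) (zeroSet (W a b c d n))) ∧
    IsLimitOfZeros (W a b c d) (u : ℂ) ∧ IsLimitOfZeros (W a b c d) (v : ℂ) := by
  have hI := exists_interlacingLists ha hB hU hV
  have hsub : ∀ n, zeroSet (W a b c d n) ⊆ Set.Ioo u v := by
    intro n x hx
    have hx : (W a b c d n).eval x = 0 := hx
    constructor
    · by_contra! hle
      have := hU x hle n
      rw [hx, mul_zero] at this
      exact this.false
    · by_contra! hle
      have := hV x hle n
      rw [hx] at this
      exact this.false
  have hex : ∀ n, 1 ≤ n → ∃ x, (W a b c d n).eval x = 0 := by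
    intro n hn
    obtain ⟨k, rfl⟩ : ∃ k, n = k + 1 := ⟨n - 1, by omega⟩
    obtain ⟨s, t, h⟩ := hI k
    exact ⟨s 0, h.1.2 0 (by omega)⟩
  have hzero : ∀ n x y, x ≤ y → (W a b c d n).eval x * (W a b c d n).eval y ≤ 0 →
      ∃ z, x ≤ z ∧ z ≤ y ∧ (W a b c d n).eval z = 0 := by
    intro n x y hxy h
    rcases h.lt_or_eq with h | h
    · have hne : x ≠ y := by
        rintro rfl
        exact absurd (mul_self_nonneg _) h.not_ge
      obtain ⟨z, h1, h2, h3⟩ := exists_root_between _ (lt_of_le_of_ne hxy hne) h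
      exact ⟨z, h1.le, h2.le, h3⟩
    · rcases mul_eq_zero.1 h with h | h
      · exact ⟨x, le_rfl, hxy, h⟩
      · exact ⟨y, hxy, le_rfl, h⟩
  refine ⟨fun n => ?_, hsub, fun n => ?_, ?_, ?_⟩
  · obtain ⟨s, t, h⟩ := hI n
    exact realRooted_W ha h.2.1
  · obtain ⟨s, t, h⟩ := hI n
    exact h.strictlyInterlaces ha
  · refine isLimitOfZeros_of_eventually hex fun ε hε => ?_
    obtain ⟨m, hm, hm'⟩ := hU'
    obtain ⟨x, hx1, hx2⟩ := exists_between (lt_min hm (lt_add_of_pos_right u hε))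
    obtain ⟨N, hN⟩ := hm' x hx1 (hx2.trans_le (min_le_left _ _))
    -- The wrong sign at x gives W_N a zero in [u, x]; by interlacing, each later polynomial has a
    -- zero further left.
    have hroot : ∀ n, N ≤ n → ∃ z, z ≤ x ∧ (W a b c d n).eval z = 0 := by
      intro n hn
      induction n, hn using Nat.le_induction with
      | base =>
        have h1 := mul_nonpos_of_nonneg_of_nonpos (hU u le_rfl N).le hN
        have h2 : ((-1 : ℝ) ^ N) * (-1) ^ N = 1 := by rw [← mul_pow]; simp
        have h3 : (W a b c d N).eval u * (W a b c d N).eval x ≤ 0 := by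
          rw [mul_mul_mul_comm, h2, one_mul] at h1
          exact h1
        obtain ⟨z, -, hz, hz0⟩ := hzero N u x hx1.le h3
        exact ⟨z, hz, hz0⟩
      | succ n _ ih =>
        obtain ⟨z, hz, hz0⟩ := ih
        obtain ⟨s, t, h⟩ := hI n
        obtain ⟨y, hy, hy0⟩ := (h.exists_lt_and_gt ha hz0).1
        exact ⟨y, hy.le.trans hz, hy0⟩
    refine ⟨N, fun n hn => ?_⟩
    obtain ⟨z, hz, hz0⟩ := hroot n hn
    have := (hsub n hz0).1
    have := hx2.trans_le (min_le_right _ _)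
    exact ⟨z, abs_lt.2 ⟨by linarith, by linarith⟩, hz0⟩
  · refine isLimitOfZeros_of_eventually hex fun ε hε => ?_
    obtain ⟨m, hm, hm'⟩ := hV'
    obtain ⟨x, hx1, hx2⟩ := exists_between (max_lt hm (sub_lt_self v hε))
    obtain ⟨N, hN⟩ := hm' x ((le_max_left _ _).trans_lt hx1) hx2
    have hroot : ∀ n, N ≤ n → ∃ z, x ≤ z ∧ (W a b c d n).eval z = 0 := by
      intro n hn
      induction n, hn using Nat.le_induction with
      | base =>
        obtain ⟨z, hz, -, hz0⟩ := hzero N x v hx2.le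
          (mul_nonpos_of_nonpos_of_nonneg hN (hV v le_rfl N).le)
        exact ⟨z, hz, hz0⟩
      | succ n _ ih =>
        obtain ⟨z, hz, hz0⟩ := ih
        obtain ⟨s, t, h⟩ := hI n
        obtain ⟨y, hy, hy0⟩ := (h.exists_lt_and_gt ha hz0).2
        exact ⟨y, hz.trans hy.le, hy0⟩
    refine ⟨N, fun n hn => ?_⟩
    obtain ⟨z, hz, hz0⟩ := hroot n hn
    have := (hsub n hz0).2
    have := (le_max_right _ _).trans_lt hx1
    exact ⟨z, abs_lt.2 ⟨by linarith, by linarith⟩, hz0⟩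

end Limits

/-! ### Sign conditions in terms of Δ and g -/

section Conditions

variable {a b c d u v : ℝ}

/-- `Δ(z) = A(z)² + 4 B(z)`. -/
def Delta (a b c d x : ℝ) : ℝ := (a * x + b) ^ 2 + 4 * (c * x + d)

/-- `g(z) = (1 - a) z² - (b + c) z - d`. -/
def g (a b c d x : ℝ) : ℝ := (1 - a) * x ^ 2 - (b + c) * x - d

/-- g(x) = x² - A(x)x - B(x) is the characteristic polynomial at the starting ratio x, and Δ(x) is
its discriminant; this is completing the square. -/
lemma four_mul_g (x : ℝ) :
    4 * g a b c d x = (2 * x - (a * x + b)) ^ 2 - Delta a b c d x := by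
  unfold g Delta; ring

/-- `u` bounds the zeros from the left, and is sharp: on `(-∞, u]` the ratios `-W_{n+1} / W_n`
stay above the smaller characteristic root, and they do not just to the right of `u`. -/
def IsLeftEnd (a b c d u : ℝ) : Prop :=
  (∀ x, x ≤ u → (a * x + b < 0 ∧ 2 * x ≤ a * x + b ∧ 0 ≤ Delta a b c d x) ∨
    (x < 0 ∧ g a b c d x ≤ 0)) ∧
  ∃ m > u, ∀ x, u < x → x < m →
    Delta a b c d x < 0 ∨ (a * x + b < 2 * x ∧ 0 < g a b c d x)

/-- The analogue of `IsLeftEnd` for the right end point. -/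
def IsRightEnd (a b c d v : ℝ) : Prop :=
  (∀ x, v ≤ x → (0 < a * x + b ∧ a * x + b ≤ 2 * x ∧ 0 ≤ Delta a b c d x) ∨
    (0 < x ∧ g a b c d x ≤ 0)) ∧
  ∃ m < v, ∀ x, m < x → x < v →
    Delta a b c d x < 0 ∨ (2 * x < a * x + b ∧ 0 < g a b c d x)

theorem zeros_of_isLeftEnd_of_isRightEnd (ha : 0 < a) (hc : 0 < c) (hd : d < 0)
    (hAB : xA a b < xB c d) (hu : IsLeftEnd a b c d u) (hv : IsRightEnd a b c d v) :
    (∀ n, RealRooted (W a b c d n)) ∧ (∀ n, zeroSet (W a b c d n) ⊆ Set.Ioo u v) ∧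
    (∀ n, StrictlyInterlaces (zeroSet (W a b c d (n + 1))) (zeroSet (W a b c d n))) ∧
    IsLimitOfZeros (W a b c d) (u : ℂ) ∧ IsLimitOfZeros (W a b c d) (v : ℂ) := by
  -- Here x_A < x_B enters: B ≥ 0 means x ≥ x_B, and then A > 0 as well, so all terms of the
  -- recurrence are nonnegative.
  have hpos : ∀ x, 0 ≤ c * x + d → ∀ n, 0 < (W a b c d n).eval x := by
    intro x hx
    have hx0 : 0 < x := by
      by_contra! h
      nlinarith
    have hxB : xB c d ≤ x := by
      rw [xB, div_le_iff₀ hc]; linarith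
    have hA : 0 < a * x + b := by
      have := hAB.trans_le hxB
      rw [xA, div_lt_iff₀ ha] at this
      linarith
    exact pos_of_nonneg_coeff (by simp [W]) (by simp [W])
      (eval_W_succ_succ a b c d x) hA hx hx0
  refine zeros_of_sign_conditions ha (fun n x h0 => ?_) (fun x hx => ?_) (fun x hx => ?_) ?_ ?_
  · by_contra! h
    exact (hpos x h n).ne' h0
  · have hx0 : x < 0 := by
      rcases hu.1 x hx with ⟨h1, h2, -⟩ | ⟨h1, -⟩ <;> linarith
    have hB : c * x + d < 0 := by nlinarith
    refine pos_of_disc_nonneg (w := fun n => (-1) ^ n * (W a b c d n).eval x) (y := -x)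
      (by simp [W]) (by simp [W]) (eval_W_alternating a b c d x) hB ?_
    rcases hu.1 x hx with ⟨h1, h2, h3⟩ | ⟨h1, h2⟩
    · refine Or.inl ⟨by linarith, by linarith, ?_⟩
      rw [neg_sq]; exact h3
    · refine Or.inr ⟨by linarith, ?_⟩
      unfold g at h2
      linarith
  · rcases le_or_gt 0 (c * x + d) with hB | hB
    · exact hpos x hB
    · refine pos_of_disc_nonneg (by simp [W]) (y := x) (by simp [W])
        (eval_W_succ_succ a b c d x) hB ?_
      rcases hv.1 x hx with h | ⟨h1, h2⟩
      · exact Or.inl h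
      · refine Or.inr ⟨h1, ?_⟩
        unfold g at h2
        linarith
  · obtain ⟨m, hm, h⟩ := hu.2
    refine ⟨m, hm, fun x h1 h2 => ?_⟩
    refine exists_nonpos (w := fun n => (-1) ^ n * (W a b c d n).eval x) (y := -x)
      (by simp [W]) (by simp [W]) (eval_W_alternating a b c d x) ?_
    rcases h x h1 h2 with h | ⟨h, h'⟩
    · left; rw [neg_sq]; exact h
    · refine Or.inr ⟨by linarith, ?_⟩
      unfold g at h'
      linarith
  · obtain ⟨m, hm, h⟩ := hv.2
    refine ⟨m, hm, fun x h1 h2 => ?_⟩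
    refine exists_nonpos (y := x) (by simp [W]) (by simp [W]) (eval_W_succ_succ a b c d x) ?_
    rcases h x h1 h2 with h | ⟨h, h'⟩
    · left; exact h
    · refine Or.inr ⟨h, ?_⟩
      unfold g at h'
      linarith

end Conditions

/-! ### Locating the end points among the zeros of Δ and g -/

section EndPoints

variable {a b c d : ℝ}

lemma sq_lt_discDelta (ha : 0 < a) (hc : 0 < c) (hAB : xA a b < xB c d) :
    c ^ 2 < discDelta a b c d := by
  have h : c * xA a b + d < 0 := by
    rw [xB, lt_div_iff₀ hc] at hAB
    linarith
  have := mul_neg_of_pos_of_neg (pow_pos ha 2) h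
  unfold discDelta
  linarith

lemma xDeltaMinus_lt_xA (ha : 0 < a) (hc : 0 < c) : xDeltaMinus a b c d < xA a b := by
  have : (-2 * c - 2 * √(discDelta a b c d)) / a ^ 2 < 0 :=
    div_neg_of_neg_of_pos (by linarith [Real.sqrt_nonneg (discDelta a b c d)]) (pow_pos ha 2)
  unfold xDeltaMinus
  linarith

lemma xA_lt_xDeltaPlus (ha : 0 < a) (hc : 0 < c) (hAB : xA a b < xB c d) :
    xA a b < xDeltaPlus a b c d := by
  have h := Real.lt_sqrt_of_sq_lt (sq_lt_discDelta ha hc hAB)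
  have : 0 < (-2 * c + 2 * √(discDelta a b c d)) / a ^ 2 :=
    div_pos (by linarith) (pow_pos ha 2)
  unfold xDeltaPlus
  linarith

lemma Delta_eq (ha : 0 < a) (hc : 0 < c) (hAB : xA a b < xB c d) (x : ℝ) :
    Delta a b c d x = a ^ 2 * ((x - xDeltaMinus a b c d) * (x - xDeltaPlus a b c d)) := by
  have hs := Real.sq_sqrt ((sq_nonneg c).trans (sq_lt_discDelta ha hc hAB).le)
  unfold xDeltaMinus xDeltaPlus
  set r := √(discDelta a b c d)
  have hr : r ^ 2 = c ^ 2 + a * b * c - a ^ 2 * d := by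
    rw [hs, discDelta, xA]; field_simp; ring
  have e : a ^ 2 * ((x - (xA a b + (-2 * c - 2 * r) / a ^ 2)) *
      (x - (xA a b + (-2 * c + 2 * r) / a ^ 2))) =
      ((a ^ 2 * (x - xA a b) + 2 * c) ^ 2 - 4 * r ^ 2) / a ^ 2 := by
    field_simp; ring
  rw [e, hr, Delta, xA]
  field_simp
  ring

lemma g_eq (h1 : a ≠ 1) (hG : 0 ≤ discG a b c d) (x : ℝ) :
    g a b c d x = (1 - a) * ((x - xGMinus a b c d) * (x - xGPlus a b c d)) := by
  have hs := Real.sq_sqrt hG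
  have h1' : 1 - a ≠ 0 := sub_ne_zero.2 h1.symm
  rw [xGMinus, xGPlus, if_neg h1, if_neg h1]
  set r := √(discG a b c d)
  have habs : |1 - a| ≠ 0 := abs_ne_zero.2 h1'
  have e : (x - ((b + c) / (2 * (1 - a)) - r / (2 * |1 - a|))) *
      (x - ((b + c) / (2 * (1 - a)) + r / (2 * |1 - a|))) =
      (x - (b + c) / (2 * (1 - a))) ^ 2 - r ^ 2 / (4 * |1 - a| ^ 2) := by
    field_simp; ring
  rw [e, sq_abs, hs, g, discG]
  field_simp
  ring

lemma xGMinus_le_xGPlus : xGMinus a b c d ≤ xGPlus a b c d := by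
  unfold xGMinus xGPlus
  split_ifs
  · exact le_rfl
  · have : 0 ≤ √(discG a b c d) / (2 * |1 - a|) := by positivity
    linarith

/-- This is what F is for: its sign tells whether b/(2 - a), the solution of A(x) = 2x, lies between
the zeros of Δ. -/
lemma sq_mul_Delta (h2 : a ≠ 2) :
    (2 - a) ^ 2 * Delta a b c d (b / (2 - a)) = 4 * F a b c d := by
  by_cases ha : a = 0
  · subst ha; unfold Delta F discG discDelta xA; simp; ring
  have : 2 - a ≠ 0 := sub_ne_zero.2 h2.symm
  unfold Delta F discG discDelta xA
  field_simp
  ring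

lemma two_mul_sub_A (h2 : a ≠ 2) (x : ℝ) :
    2 * x - (a * x + b) = (2 - a) * (x - b / (2 - a)) := by
  have : 2 - a ≠ 0 := sub_ne_zero.2 h2.symm
  field_simp
  ring

lemma four_mul_g_div (h2 : a ≠ 2) :
    4 * g a b c d (b / (2 - a)) = -Delta a b c d (b / (2 - a)) := by
  rw [four_mul_g, two_mul_sub_A h2]; ring

lemma xA_pos (ha : 0 < a) (hb : b < 0) : 0 < xA a b := div_pos (by linarith) ha

lemma A_eq (ha : 0 < a) (x : ℝ) : a * x + b = a * (x - xA a b) := by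
  unfold xA; field_simp; ring

lemma Delta_neg_of_mem_Ioo (ha : 0 < a) (hc : 0 < c) (hAB : xA a b < xB c d) {x : ℝ}
    (h1 : xDeltaMinus a b c d < x) (h2 : x < xDeltaPlus a b c d) : Delta a b c d x < 0 := by
  rw [Delta_eq ha hc hAB]
  exact mul_neg_of_pos_of_neg (pow_pos ha 2)
    (mul_neg_of_pos_of_neg (sub_pos.2 h1) (sub_neg.2 h2))

lemma Delta_nonneg_of_xDeltaPlus_le (ha : 0 < a) (hc : 0 < c) (hAB : xA a b < xB c d) {x : ℝ}
    (h : xDeltaPlus a b c d ≤ x) : 0 ≤ Delta a b c d x := by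
  have h1 := xDeltaMinus_lt_xA (b := b) (d := d) ha hc
  have h2 := xA_lt_xDeltaPlus ha hc hAB
  rw [Delta_eq ha hc hAB]
  exact mul_nonneg (sq_nonneg a) (mul_nonneg (by linarith) (by linarith))

lemma Delta_nonneg_of_le_xDeltaMinus (ha : 0 < a) (hc : 0 < c) (hAB : xA a b < xB c d) {x : ℝ}
    (h : x ≤ xDeltaMinus a b c d) : 0 ≤ Delta a b c d x := by
  have h1 := xDeltaMinus_lt_xA (b := b) (d := d) ha hc
  have h2 := xA_lt_xDeltaPlus ha hc hAB
  rw [Delta_eq ha hc hAB]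
  exact mul_nonneg (sq_nonneg a) (mul_nonneg_of_nonpos_of_nonpos (by linarith) (by linarith))

lemma xDeltaMinus_le_of_Delta_nonpos (ha : 0 < a) (hc : 0 < c) (hAB : xA a b < xB c d) {x : ℝ}
    (h : Delta a b c d x ≤ 0) : xDeltaMinus a b c d ≤ x ∧ x ≤ xDeltaPlus a b c d := by
  have h1 := xDeltaMinus_lt_xA (b := b) (d := d) ha hc
  have h2 := xA_lt_xDeltaPlus ha hc hAB
  rw [Delta_eq ha hc hAB] at h
  have h := nonpos_of_mul_nonpos_right h (pow_pos ha 2)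
  constructor <;> by_contra! hlt
  · exact absurd (mul_pos_of_neg_of_neg (sub_neg.2 hlt)
      (sub_neg.2 (hlt.trans (h1.trans h2)))) h.not_gt
  · exact absurd (mul_pos (sub_pos.2 ((h1.trans h2).trans hlt)) (sub_pos.2 hlt)) h.not_gt

/-- Sharpness is automatic, since Δ < 0 between its zeros. To the right, x exceeds x_A > 0, so the
signs of A, x and Δ come for free. -/
lemma isRightEnd_xDeltaPlus (ha : 0 < a) (hc : 0 < c) (hb : b < 0) (hAB : xA a b < xB c d)
    (h : ∀ x, xDeltaPlus a b c d ≤ x → a * x + b ≤ 2 * x ∨ g a b c d x ≤ 0) :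
    IsRightEnd a b c d (xDeltaPlus a b c d) := by
  have h1 := xDeltaMinus_lt_xA (b := b) (d := d) ha hc
  have h2 := xA_lt_xDeltaPlus ha hc hAB
  have h3 := xA_pos ha hb
  refine ⟨fun x hx => ?_, xDeltaMinus a b c d, h1.trans h2, fun x h1 h2 =>
    Or.inl (Delta_neg_of_mem_Ioo ha hc hAB h1 h2)⟩
  rcases h x hx with h | h
  · refine Or.inl ⟨?_, h, Delta_nonneg_of_xDeltaPlus_le ha hc hAB hx⟩
    rw [A_eq ha]
    exact mul_pos ha (by linarith)
  · exact Or.inr ⟨by linarith, h⟩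

lemma isLeftEnd_xDeltaMinus (ha : 0 < a) (hc : 0 < c) (hAB : xA a b < xB c d)
    (h : ∀ x, x ≤ xDeltaMinus a b c d → 2 * x ≤ a * x + b) :
    IsLeftEnd a b c d (xDeltaMinus a b c d) := by
  have h1 := xDeltaMinus_lt_xA (b := b) (d := d) ha hc
  have h2 := xA_lt_xDeltaPlus ha hc hAB
  refine ⟨fun x hx => Or.inl ⟨?_, h x hx, Delta_nonneg_of_le_xDeltaMinus ha hc hAB hx⟩,
    xDeltaPlus a b c d, h1.trans h2, fun x h1 h2 =>
    Or.inl (Delta_neg_of_mem_Ioo ha hc hAB h1 h2)⟩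
  rw [A_eq ha]
  exact mul_neg_of_pos_of_neg ha (by linarith)

/-- For `a ≥ 1` the zero `x_g⁻` is negative, `g` is nonpositive to the left of it, and positive
between it and `0`. -/
lemma g_sign_left (h1 : 1 ≤ a) (hd : d < 0) (hbc : a = 1 → b + c < 0) :
    xGMinus a b c d < 0 ∧ (∀ x, x ≤ xGMinus a b c d → g a b c d x ≤ 0) ∧
      ∀ x, xGMinus a b c d < x → x ≤ 0 → 0 < g a b c d x := by
  rcases h1.eq_or_lt with h | h1
  · have hbc := hbc h.symm
    have hx : xGMinus a b c d = -d / (b + c) := by rw [xGMinus, if_pos h.symm]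
    have hg : ∀ x, g a b c d x = -(b + c) * (x - -d / (b + c)) := by
      intro x
      have := hbc.ne
      rw [g, ← h]
      field_simp
      ring
    rw [hx]
    refine ⟨div_neg_of_pos_of_neg (by linarith) hbc, fun x h => ?_, fun x h _ => ?_⟩
    · rw [hg]; exact mul_nonpos_of_nonneg_of_nonpos (by linarith) (by linarith)
    · rw [hg]; exact mul_pos (by linarith) (by linarith)
  · have hG : 0 ≤ discG a b c d := by
      unfold discG
      nlinarith [sq_nonneg (b + c)]
    have hg := g_eq (b := b) (c := c) h1.ne' hG
    have hle := xGMinus_le_xGPlus (a := a) (b := b) (c := c) (d := d)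
    -- Evaluating at 0 gives the product of the zeros, -d/(1 - a), which is negative for a > 1.
    have h0 := hg 0
    have hprod : xGMinus a b c d * xGPlus a b c d < 0 := by
      unfold g at h0
      nlinarith
    obtain ⟨hm, hp⟩ : xGMinus a b c d < 0 ∧ 0 < xGPlus a b c d := by
      rcases mul_neg_iff.1 hprod with h | h
      · linarith [h.1, h.2]
      · exact h
    refine ⟨hm, fun x h => ?_, fun x h h' => ?_⟩
    · rw [hg]
      exact mul_nonpos_of_nonpos_of_nonneg (by linarith)
        (mul_nonneg_of_nonpos_of_nonpos (by linarith) (by linarith))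
    · rw [hg]
      exact mul_pos_of_neg_of_neg (by linarith)
        (mul_neg_of_pos_of_neg (by linarith) (by linarith))

lemma g_sign_right (h1 : 1 < a) (hd : d < 0) :
    0 < xGPlus a b c d ∧ (∀ x, xGPlus a b c d ≤ x → g a b c d x ≤ 0) ∧
      (∀ x, 0 ≤ x → x < xGPlus a b c d → 0 < g a b c d x) := by
  have hG : 0 ≤ discG a b c d := by
    unfold discG
    nlinarith [sq_nonneg (b + c)]
  have hg := g_eq (b := b) (c := c) h1.ne' hG
  have hm := (g_sign_left (b := b) (c := c) h1.le hd (fun h => absurd h h1.ne')).1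
  have h0 := hg 0
  have hp : 0 < xGPlus a b c d := by
    unfold g at h0
    by_contra! hle
    nlinarith [mul_nonneg_of_nonpos_of_nonpos hm.le hle]
  refine ⟨hp, fun x h => ?_, fun x h h' => ?_⟩
  · rw [hg]
    exact mul_nonpos_of_nonpos_of_nonneg (by linarith)
      (mul_nonneg (by linarith) (by linarith))
  · rw [hg]
    exact mul_pos_of_neg_of_neg (by linarith)
      (mul_neg_of_pos_of_neg (by linarith) (by linarith))

lemma isLeftEnd_xGMinus (h1 : 1 ≤ a) (hd : d < 0) (hbc : a = 1 → b + c < 0)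
    (h : ∀ x, xGMinus a b c d < x → x ≤ 0 → a * x + b < 2 * x) :
    IsLeftEnd a b c d (xGMinus a b c d) := by
  obtain ⟨hm, hle, hlt⟩ := g_sign_left h1 hd hbc
  exact ⟨fun x hx => Or.inr ⟨by linarith, hle x hx⟩, 0, hm,
    fun x h1 h2 => Or.inr ⟨h x h1 h2.le, hlt x h1 h2.le⟩⟩

/-- The position of `b / (2 - a)` when `a < 2` and `F > 0`. -/
lemma div_lt_xDeltaMinus (ha : 0 < a) (hc : 0 < c) (hb : b < 0) (hAB : xA a b < xB c d)
    (h2 : a < 2) (hF : 0 < F a b c d) :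
    b / (2 - a) < xDeltaMinus a b c d ∧ g a b c d (b / (2 - a)) < 0 := by
  have hD : 0 < Delta a b c d (b / (2 - a)) := by
    have h := sq_mul_Delta (b := b) (c := c) (d := d) h2.ne
    by_contra! hle
    nlinarith [mul_nonpos_of_nonneg_of_nonpos (sq_nonneg (2 - a)) hle]
  have hz : b / (2 - a) < 0 := div_neg_of_neg_of_pos hb (by linarith)
  refine ⟨?_, by linarith [four_mul_g_div (b := b) (c := c) (d := d) h2.ne]⟩
  by_contra! hle
  have h3 := xA_lt_xDeltaPlus ha hc hAB
  have h4 := xA_pos ha hb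
  rw [Delta_eq ha hc hAB] at hD
  have := mul_nonpos_of_nonneg_of_nonpos (sub_nonneg.2 hle)
    (show b / (2 - a) - xDeltaPlus a b c d ≤ 0 by linarith)
  nlinarith [mul_nonpos_of_nonneg_of_nonpos (sq_nonneg a) this]

/-- The zero `x_g⁺` is the left end point for `a < 1` and `F > 0`. -/
lemma isLeftEnd_xGPlus (ha : 0 < a) (hc : 0 < c) (hb : b < 0) (hd : d < 0)
    (hAB : xA a b < xB c d) (h1 : a < 1) (hF : 0 < F a b c d) :
    IsLeftEnd a b c d (xGPlus a b c d) := by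
  obtain ⟨hz, hgz⟩ := div_lt_xDeltaMinus ha hc hb hAB (by linarith) hF
  have hz0 : b / (2 - a) < 0 := div_neg_of_neg_of_pos hb (by linarith)
  have hG : 0 ≤ discG a b c d := by
    have := sq_lt_discDelta ha hc hAB
    unfold F at hF
    nlinarith [sq_nonneg c]
  have hg := g_eq h1.ne hG
  have hle := xGMinus_le_xGPlus (a := a) (b := b) (c := c) (d := d)
  have hA := two_mul_sub_A (b := b) (show a ≠ 2 by linarith)
  have hxA := xDeltaMinus_lt_xA (b := b) (d := d) ha hc
  set z := b / (2 - a)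
  -- For a < 1 the parabola g opens upward, so g(z) < 0 puts z strictly between the zeros.
  obtain ⟨hmz, hzp⟩ : xGMinus a b c d < z ∧ z < xGPlus a b c d := by
    rw [hg] at hgz
    rcases mul_neg_iff.1 (neg_of_mul_neg_right hgz (by linarith)) with h | h
    · exact ⟨by linarith [h.1], by linarith [h.2]⟩
    · linarith [h.1, h.2]
  have hp : xGPlus a b c d < 0 := by
    have h0 := hg 0
    by_contra! hge
    have hm : xGMinus a b c d < 0 := by linarith
    unfold g at h0
    nlinarith [mul_nonpos_of_nonpos_of_nonneg hm.le hge]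
  refine ⟨fun x hx => ?_, 0, hp, fun x h h' => Or.inr ⟨?_, ?_⟩⟩
  -- Left of z the discriminant criterion applies; on [z, x_g⁺] the criterion g ≤ 0 takes over.
  · rcases le_total x z with h | h
    · refine Or.inl ⟨?_, ?_, Delta_nonneg_of_le_xDeltaMinus ha hc hAB (by linarith)⟩
      · rw [A_eq ha]; exact mul_neg_of_pos_of_neg ha (by linarith)
      · have := mul_nonpos_of_nonneg_of_nonpos (show 0 ≤ 2 - a by linarith) (sub_nonpos.2 h)
        linarith [hA x]
    · refine Or.inr ⟨by linarith, ?_⟩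
      rw [hg]
      exact mul_nonpos_of_nonneg_of_nonpos (by linarith)
        (mul_nonpos_of_nonneg_of_nonpos (by linarith) (by linarith))
  · have := mul_pos (show 0 < 2 - a by linarith) (show 0 < x - z by linarith)
    linarith [hA x]
  · rw [hg]
    exact mul_pos (by linarith) (mul_pos (by linarith) (by linarith))

lemma isRightEnd_xDeltaPlus_of_div_le (ha : 0 < a) (hc : 0 < c) (hb : b < 0)
    (hAB : xA a b < xB c d) (h2 : a < 2) (hz : b / (2 - a) ≤ xDeltaPlus a b c d) :
    IsRightEnd a b c d (xDeltaPlus a b c d) := by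
  refine isRightEnd_xDeltaPlus ha hc hb hAB fun x hx => Or.inl ?_
  have := mul_nonneg (show 0 ≤ 2 - a by linarith) (sub_nonneg.2 (hz.trans hx))
  linarith [two_mul_sub_A (b := b) h2.ne x]

/-- F ≤ 0 places b/(2 - a) between the zeros of Δ, so outside them 2x - A already has the required
sign on each side. -/
lemma isEnd_of_lt_two_of_F_nonpos (ha : 0 < a) (hc : 0 < c) (hb : b < 0)
    (hAB : xA a b < xB c d) (h2 : a < 2) (hF : F a b c d ≤ 0) :
    IsLeftEnd a b c d (xDeltaMinus a b c d) ∧ IsRightEnd a b c d (xDeltaPlus a b c d) := by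
  have hD : Delta a b c d (b / (2 - a)) ≤ 0 := by
    have h := sq_mul_Delta (b := b) (c := c) (d := d) h2.ne
    have hpos : 0 < (2 - a) ^ 2 := pow_pos (by linarith) 2
    by_contra! hlt
    nlinarith [mul_pos hpos hlt]
  obtain ⟨hm, hp⟩ := xDeltaMinus_le_of_Delta_nonpos ha hc hAB hD
  refine ⟨isLeftEnd_xDeltaMinus ha hc hAB fun x hx => ?_,
    isRightEnd_xDeltaPlus_of_div_le ha hc hb hAB h2 hp⟩
  have := mul_nonpos_of_nonneg_of_nonpos (show 0 ≤ 2 - a by linarith)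
    (sub_nonpos.2 (hx.trans hm))
  linarith [two_mul_sub_A (b := b) h2.ne x]

lemma isLeftEnd_xGMinus_of_two_le (hb : b < 0) (hd : d < 0) (h2 : 2 ≤ a) :
    IsLeftEnd a b c d (xGMinus a b c d) := by
  refine isLeftEnd_xGMinus (by linarith) hd (fun h => by linarith) fun x _ hx => ?_
  nlinarith

/-- For a > 2 the point b/(2 - a) is positive, and F < 0 makes g positive there, so it precedes
x_g⁺; between the two, 2x < A and g > 0. -/
lemma isRightEnd_xGPlus (hb : b < 0) (hd : d < 0) (h2 : 2 < a) (hF : F a b c d < 0) :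
    IsRightEnd a b c d (xGPlus a b c d) := by
  obtain ⟨hp, hle, hlt⟩ := g_sign_right (b := b) (c := c) (show 1 < a by linarith) hd
  have hz0 : 0 < b / (2 - a) := div_pos_of_neg_of_neg hb (by linarith)
  have hgz : 0 < g a b c d (b / (2 - a)) := by
    have h := sq_mul_Delta (b := b) (c := c) (d := d) h2.ne'
    have h4 := four_mul_g_div (b := b) (c := c) (d := d) h2.ne'
    by_contra! hle'
    nlinarith [mul_nonpos_of_nonneg_of_nonpos (sq_nonneg (2 - a)) hle']
  refine ⟨fun x hx => Or.inr ⟨by linarith, hle x hx⟩, b / (2 - a), ?_, fun x h h' =>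
    Or.inr ⟨?_, hlt x (by linarith) h'⟩⟩
  · by_contra! h
    exact (hle _ h).not_gt hgz
  · have := mul_neg_of_neg_of_pos (show 2 - a < 0 by linarith) (sub_pos.2 h)
    linarith [two_mul_sub_A (b := b) h2.ne' x]

/-- Now g ≤ 0 at b/(2 - a), hence everywhere to its right, while to its left A ≤ 2x; one of the two
alternatives always holds. -/
lemma isRightEnd_xDeltaPlus_of_two_lt (ha : 0 < a) (hc : 0 < c) (hb : b < 0) (hd : d < 0)
    (hAB : xA a b < xB c d) (h2 : 2 < a) (hF : 0 ≤ F a b c d) :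
    IsRightEnd a b c d (xDeltaPlus a b c d) := by
  obtain ⟨hp, hle, hlt⟩ := g_sign_right (b := b) (c := c) (show 1 < a by linarith) hd
  have hz0 : 0 < b / (2 - a) := div_pos_of_neg_of_neg hb (by linarith)
  have hgz : g a b c d (b / (2 - a)) ≤ 0 := by
    have h := sq_mul_Delta (b := b) (c := c) (d := d) h2.ne'
    have h4 := four_mul_g_div (b := b) (c := c) (d := d) h2.ne'
    have hpos : 0 < (2 - a) ^ 2 := by nlinarith
    by_contra! hlt'
    nlinarith [mul_pos hpos hlt']
  have hzp : xGPlus a b c d ≤ b / (2 - a) := by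
    by_contra! h
    exact (hlt _ hz0.le h).not_ge hgz
  refine isRightEnd_xDeltaPlus ha hc hb hAB fun x _ => ?_
  rcases le_total x (b / (2 - a)) with h | h
  · left
    have := mul_nonneg_of_nonpos_of_nonpos (show 2 - a ≤ 0 by linarith) (sub_nonpos.2 h)
    linarith [two_mul_sub_A (b := b) h2.ne' x]
  · exact Or.inr (hle x (hzp.trans h))

/-- The zero `x_g⁻` is the left end point for `1 ≤ a < 2` and `F > 0`. -/
lemma isLeftEnd_xGMinus_of_lt_two (ha : 0 < a) (hc : 0 < c) (hb : b < 0) (hd : d < 0)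
    (hAB : xA a b < xB c d) (h1 : 1 ≤ a) (h2 : a < 2) (hF : 0 < F a b c d) :
    IsLeftEnd a b c d (xGMinus a b c d) := by
  have hgz := (div_lt_xDeltaMinus ha hc hb hAB h2 hF).2
  have hz0 : b / (2 - a) < 0 := div_neg_of_neg_of_pos hb (by linarith)
  -- For a = 1 the point is b itself, and g(b) < 0 says (b + c)b > -d > 0.
  have hbc : a = 1 → b + c < 0 := by
    rintro rfl
    norm_num [g] at hgz
    nlinarith
  obtain ⟨-, -, hlt⟩ := g_sign_left h1 hd hbc
  refine isLeftEnd_xGMinus h1 hd hbc fun x hx _ => ?_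
  have hz : b / (2 - a) ≤ xGMinus a b c d := by
    by_contra! h
    exact (hlt _ h hz0.le).not_gt hgz
  have := mul_pos (show 0 < 2 - a by linarith) (show 0 < x - b / (2 - a) by linarith)
  linarith [two_mul_sub_A (b := b) h2.ne x]

theorem isLeftEnd_u_and_isRightEnd_v (ha : 0 < a) (hc : 0 < c) (hb : b < 0) (hd : d < 0)
    (hAB : xA a b < xB c d) :
    IsLeftEnd a b c d (u a b c d) ∧ IsRightEnd a b c d (v a b c d) := by
  unfold u v uv
  have hright : a < 2 → 0 < F a b c d → IsRightEnd a b c d (xDeltaPlus a b c d) := by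
    intro h2 hF
    refine isRightEnd_xDeltaPlus_of_div_le ha hc hb hAB h2 ?_
    have := (div_lt_xDeltaMinus ha hc hb hAB h2 hF).1
    have := xDeltaMinus_lt_xA (b := b) (d := d) ha hc
    have := xA_lt_xDeltaPlus ha hc hAB
    linarith
  split_ifs with hA hB hC
  · exact isEnd_of_lt_two_of_F_nonpos ha hc hb hAB hA.1 hA.2
  · exact ⟨isLeftEnd_xGMinus_of_two_le hb hd hB.1.le, isRightEnd_xGPlus hb hd hB.1 hB.2⟩
  · exact ⟨isLeftEnd_xGPlus ha hc hb hd hAB hC.1 hC.2, hright (by linarith [hC.1]) hC.2⟩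
  · rcases lt_trichotomy a 2 with h2 | h2 | h2
    · have hF : 0 < F a b c d := by
        by_contra! h
        exact hA ⟨h2, h⟩
      have h1 : 1 ≤ a := by
        by_contra! h
        exact hC ⟨h, hF⟩
      exact ⟨isLeftEnd_xGMinus_of_lt_two ha hc hb hd hAB h1 h2 hF, hright h2 hF⟩
    · refine ⟨isLeftEnd_xGMinus_of_two_le hb hd h2.ge,
        isRightEnd_xDeltaPlus ha hc hb hAB fun x _ => Or.inl ?_⟩
      rw [h2]
      linarith
    · have hF : 0 ≤ F a b c d := by
        by_contra! h
        exact hB ⟨h2, h⟩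
      exact ⟨isLeftEnd_xGMinus_of_two_le hb hd h2.le,
        isRightEnd_xDeltaPlus_of_two_lt ha hc hb hd hAB h2 hF⟩

end EndPoints

end LinearRecurrence

theorem mainTheorem3 (a b c d : ℝ) (ha : 0 < a) (hc : 0 < c) (hb : b < 0) (hd : d < 0)
    (hAB : LinearRecurrence.xA a b < LinearRecurrence.xB c d) :
    (∀ n : ℕ, LinearRecurrence.RealRooted (LinearRecurrence.W a b c d n)) ∧
    (∀ n : ℕ, LinearRecurrence.zeroSet (LinearRecurrence.W a b c d n) ⊆
      Set.Ioo (LinearRecurrence.u a b c d) (LinearRecurrence.v a b c d)) ∧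
    (∀ n : ℕ, LinearRecurrence.StrictlyInterlaces
      (LinearRecurrence.zeroSet (LinearRecurrence.W a b c d (n + 1)))
      (LinearRecurrence.zeroSet (LinearRecurrence.W a b c d n))) ∧
    LinearRecurrence.IsLimitOfZeros (LinearRecurrence.W a b c d)
      ((LinearRecurrence.u a b c d : ℝ) : ℂ) ∧
    LinearRecurrence.IsLimitOfZeros (LinearRecurrence.W a b c d)
      ((LinearRecurrence.v a b c d : ℝ) : ℂ) := by
  obtain ⟨hu, hv⟩ := LinearRecurrence.isLeftEnd_u_and_isRightEnd_v ha hc hb hd hAB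
  exact LinearRecurrence.zeros_of_isLeftEnd_of_isRightEnd ha hc hd hAB hu hv
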